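/- Let $\zeta$ be the Riemann zeta function and $\mathrm{Li}_m(z)=\sum_{n\ge 1} z^n/n^m$ the polylogarithm, and write $\ln(x)^k$ for $(\ln x)^k$. The following ten integrals converge absolutely and have the stated values: \begin{align*} &\int_0^\infty \tfrac14\ln(1+e^{-u})\,du=\frac{\pi^2}{48},\\ &\int_0^\infty u\ln(1+e^{-u})\,du=\tfrac34\zeta(3),\\ &\int_0^\infty \ln(1+e^{-u})^2\,du=\frac{\zeta(3)}4,\\ &\int_0^\infty \frac{u^3e^{-u}}{1+e^{-u}}\,du=\frac{7\pi^4}{120},\\ &\int_0^\infty \ln(1+e^{-u})^3\,du=\tfrac14\pi^2\ln(2)^2-\tfrac{21}4\ln(2)\zeta(3)-6\,\mathrm{Li}_4(\tfrac12)+\tfrac1{15}\pi^4-\tfrac14\ln(2)^4,\\ &\int_0^\infty u\ln(1+e^{-u})^2\,du=4\,\mathrm{Li}_4(\tfrac12)-\tfrac1{24}\pi^4-\tfrac16\pi^2\ln(2)^2+\tfrac16\ln(2)^4+\tfrac72\ln(2)\zeta(3),\\ &\int_0^\infty \frac{u^4e^{-u}}{1+e^{-u}}\,du=\tfrac{45}2\zeta(5),\\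 &\int_0^\infty u\ln(1+e^{-u})^3\,du=12\,\mathrm{Li}_5(\tfrac12)+12\ln(2)\mathrm{Li}_4(\tfrac12)+\tfrac25\ln(2)^5+\tfrac{21}4\zeta(3)\ln(2)^2-\tfrac{99}{16}\zeta(5)-\tfrac13\pi^2\ln(2)^3-\tfrac12\zeta(3)\pi^2,\\ &\int_0^\infty \frac{u^3e^{-u}\ln(1+e^{-u})}{1+e^{-u}}\,du=-\tfrac{87}{16}\zeta(5)+\tfrac12\pi^2\zeta(3),\\ &\int_0^\infty \ln(1+e^{-u})^4\,du=\tfrac23\pi^2\ln(2)^3-\tfrac{21}2\ln(2)^2\zeta(3)-24\ln(2)\mathrm{Li}_4(\tfrac12)-\tfrac45\ln(2)^5-24\,\mathrm{Li}_5(\tfrac12)+24\zeta(5). \end{align*} -/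

import Mathlib

/-- The polylogarithm `Li_m(z) = ∑_{n ≥ 1} z ^ n / n ^ m` of integer order, for real `z`. -/
noncomputable def polylog (m : ℕ) (z : ℝ) : ℝ :=
  ∑' n : ℕ, z ^ (n + 1) / ((n : ℝ) + 1) ^ m

/-- The defining series of `Li_m(z)` converges for `|z| < 1`. -/
theorem hasSum_polylog (m : ℕ) {z : ℝ} (hz : |z| < 1) :
    HasSum (fun n : ℕ => z ^ (n + 1) / ((n : ℝ) + 1) ^ m) (polylog m z) := by
  refine Summable.hasSum ?_
  refine Summable.of_norm_bounded (g := fun n : ℕ => |z| ^ (n + 1))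
    ((summable_nat_add_iff 1).2 (summable_geometric_of_lt_one (abs_nonneg z) hz)) fun n => ?_
  rw [Real.norm_eq_abs, abs_div, abs_pow, abs_pow, abs_of_nonneg (by positivity : (0 : ℝ) ≤ n + 1)]
  exact div_le_self (by positivity) (one_le_pow₀ (by linarith [Nat.cast_nonneg (α := ℝ) n]))

/-- The value of the Riemann zeta function at a natural number, as a real number. -/
noncomputable def zetaR (k : ℕ) : ℝ := (riemannZeta k).re

/-- For `k ≥ 2` no information is lost in `zetaR`: the value `ζ(k)` is real. -/
theorem zetaR_eq {k : ℕ} (hk : 1 < k) : (zetaR k : ℂ) = riemannZeta k := by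
  have h : riemannZeta k = ((∑' n : ℕ, 1 / (n : ℝ) ^ k : ℝ) : ℂ) := by
    rw [zeta_nat_eq_tsum_of_gt_one hk, Complex.ofReal_tsum]
    simp
  rw [zetaR, h, Complex.ofReal_re]

/-- `∫₀^∞ f(u) du` exists as a Lebesgue integral and is equal to `a`. -/
def HasHalfLineIntegral (f : ℝ → ℝ) (a : ℝ) : Prop :=
  MeasureTheory.IntegrableOn f (Set.Ioi 0) ∧ ∫ u in Set.Ioi (0 : ℝ), f u = a

open MeasureTheory Set Filter Topology

/-! Write L = log(1 + e^{-u}), f = e^{-u}/(1 + e^{-u}) and M(a,b) = ∫ u^b L^a over u > 0; call a + b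
+ 1 the weight. Expanding in powers of e^{-u} and integrating termwise turns the integrals of u^k f
and the moments M(1,b) into alternating zeta values. The other moments come from three sources.

Since L' = -f and e^{-L} = 1 - f, the integrand L^a has an antiderivative built from powers of L and
polylogarithms at 1 - f, which runs from 1/2 to 1. Hence M(a,0) is a combination of zeta values, log
2 and Li_k(1/2) (`logMoment_zero_right`).

The map u ↦ L(u) is a decreasing bijection from ℝ to (0,∞), and L(-u) = u + L(u). Folding ℝ at 0
therefore turns integrals over t > 0 into half-line integrals in u and L. The Bose integral then
gives one linear relation in each weight (`sum_choose_mul_logMoment_add_logMoment`), and Euler's sum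
of H_n/n^4 gives a second one in weight five (`logMoment_euler`).

In weights three and four the first relation suffices; in weight five the two together yield M(2,2)
and M(3,1). The integral of u^3 L f is 3/2 M(2,2) by parts. -/

/-! ### Termwise integration on the half-line -/

/-- The total mass of `u ^ k * exp (-r * u)` on the half-line. -/
theorem integral_pow_mul_exp_neg_mul_Ioi (k : ℕ) {r : ℝ} (hr : 0 < r) :
    ∫ u in Ioi (0 : ℝ), u ^ k * Real.exp (-(r * u)) = k.factorial / r ^ (k + 1) := by
  have h := Real.integral_rpow_mul_exp_neg_mul_Ioi (a := k + 1) (by positivity) hr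
  rw [Real.Gamma_nat_eq_factorial, ← Nat.cast_add_one, Real.rpow_natCast, one_div, inv_pow] at h
  rw [div_eq_inv_mul, ← h]
  refine setIntegral_congr_fun measurableSet_Ioi fun u _ => ?_
  simp [← Real.rpow_natCast]

theorem integrableOn_pow_mul_exp_neg_mul_Ioi (k : ℕ) {r : ℝ} (hr : 0 < r) :
    IntegrableOn (fun u : ℝ => u ^ k * Real.exp (-(r * u))) (Ioi 0) :=
  -- A non-integrable function has integral 0 by convention, so a nonzero value forces
  -- integrability.
  not_imp_comm.1 integral_undef <| by
    rw [integral_pow_mul_exp_neg_mul_Ioi k hr]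
    positivity

/-- Termwise integration of a series with summable `L¹` norms: the sum is integrable. -/
theorem integrable_of_hasSum_of_summable_integral_norm {α ι : Type*} [MeasurableSpace α]
    {μ : Measure α} [Countable ι] {F : ι → α → ℝ} {G : α → ℝ} (hF : ∀ i, Integrable (F i) μ)
    (hs : Summable fun i => ∫ a, ‖F i a‖ ∂μ) (hG : ∀ᵐ a ∂μ, HasSum (fun i => F i a) (G a)) :
    Integrable G μ := by
  have hm : AEStronglyMeasurable (fun a => ∑' i, F i a) μ :=
    (AEMeasurable.tsum fun i => (hF i).aemeasurable).aestronglyMeasurable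
  refine ⟨hm.congr (hG.mono fun a h => h.tsum_eq), ?_⟩
  refine lt_of_le_of_lt (b := ∫⁻ a, ∑' i, ‖F i a‖ₑ ∂μ) (lintegral_mono_ae ?_) ?_
  · filter_upwards [hG] with a h
    rw [← h.tsum_eq]
    exact enorm_tsum_le_tsum_enorm
  · rw [lintegral_tsum fun i => (hF i).aestronglyMeasurable.enorm]
    simp_rw [← ofReal_integral_norm_eq_lintegral_enorm (hF _)]
    rw [← ENNReal.ofReal_tsum_of_nonneg (fun i => integral_nonneg fun a => norm_nonneg _) hs]
    exact ENNReal.ofReal_lt_top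

/-- Mellin-type integral of a general Dirichlet series in `exp (-u)`. -/
theorem hasHalfLineIntegral_pow_mul_of_hasSum {ι : Type*} [Countable ι] (k : ℕ) {c r : ι → ℝ}
    (hr : ∀ i, 0 < r i) {F : ℝ → ℝ} {s : ℝ}
    (habs : Summable fun i => |c i| / r i ^ (k + 1)) (hs : HasSum (fun i => c i / r i ^ (k + 1)) s)
    (hF : ∀ u, 0 < u → HasSum (fun i => c i * Real.exp (-(r i * u))) (F u)) :
    HasHalfLineIntegral (fun u => u ^ k * F u) (k.factorial * s) := by
  set f : ι → ℝ → ℝ := fun i u => c i * (u ^ k * Real.exp (-(r i * u))) with hf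
  have hint i : IntegrableOn (f i) (Ioi 0) :=
    (integrableOn_pow_mul_exp_neg_mul_Ioi k (hr i)).const_mul _
  have hnorm i : ∫ u in Ioi (0 : ℝ), ‖f i u‖ = k.factorial * (|c i| / r i ^ (k + 1)) := by
    rw [mul_div_left_comm, ← integral_pow_mul_exp_neg_mul_Ioi k (hr i), ← integral_const_mul]
    refine setIntegral_congr_fun measurableSet_Ioi fun u hu => ?_
    have : (0 : ℝ) < u := hu
    simp only [hf, norm_mul, Real.norm_eq_abs, Real.abs_exp, abs_pow, abs_of_pos this]
  have hsum : Summable fun i => ∫ u in Ioi (0 : ℝ), ‖f i u‖ := by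
    simp_rw [hnorm]
    exact habs.mul_left _
  have hFsum : ∀ u ∈ Ioi (0 : ℝ), HasSum (fun i => f i u) (u ^ k * F u) := fun u hu => by
    rw [show (fun i => f i u) = fun i => u ^ k * (c i * Real.exp (-(r i * u))) from
      funext fun i => mul_left_comm _ _ _]
    exact (hF u hu).mul_left _
  have hae : ∀ᵐ u ∂(volume.restrict (Ioi (0 : ℝ))), HasSum (fun i => f i u) (u ^ k * F u) :=
    (ae_restrict_iff' measurableSet_Ioi).2 (ae_of_all _ hFsum)
  refine ⟨integrable_of_hasSum_of_summable_integral_norm hint hsum hae, ?_⟩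
  have h := hasSum_integral_of_summable_integral_norm hint hsum
  rw [integral_congr_ae (hae.mono fun u h => h.tsum_eq)] at h
  refine h.unique ?_
  rw [show (fun i => ∫ u in Ioi (0 : ℝ), f i u) = fun i => k.factorial * (c i / r i ^ (k + 1)) from
    funext fun i => by
      rw [integral_const_mul, integral_pow_mul_exp_neg_mul_Ioi k (hr i), mul_div_left_comm]]
  exact hs.mul_left _

/-! ### Calculus of half-line integrals -/

theorem HasHalfLineIntegral.congr {f g : ℝ → ℝ} {a : ℝ} (hf : HasHalfLineIntegral f a)
    (h : ∀ u, 0 < u → f u = g u) : HasHalfLineIntegral g a :=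
  ⟨hf.1.congr_fun (fun u hu => h u hu) measurableSet_Ioi, by
    rw [← hf.2]; exact setIntegral_congr_fun measurableSet_Ioi fun u hu => (h u hu).symm⟩

theorem HasHalfLineIntegral.add {f g : ℝ → ℝ} {a b : ℝ} (hf : HasHalfLineIntegral f a)
    (hg : HasHalfLineIntegral g b) : HasHalfLineIntegral (fun u => f u + g u) (a + b) :=
  ⟨hf.1.add hg.1, by rw [integral_add hf.1 hg.1, hf.2, hg.2]⟩

theorem HasHalfLineIntegral.const_mul {f : ℝ → ℝ} {a : ℝ} (hf : HasHalfLineIntegral f a) (c : ℝ) :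
    HasHalfLineIntegral (fun u => c * f u) (c * a) :=
  ⟨hf.1.const_mul c, by rw [integral_const_mul, hf.2]⟩

theorem HasHalfLineIntegral.sub {f g : ℝ → ℝ} {a b : ℝ} (hf : HasHalfLineIntegral f a)
    (hg : HasHalfLineIntegral g b) : HasHalfLineIntegral (fun u => f u - g u) (a - b) :=
  ⟨hf.1.sub hg.1, by rw [integral_sub hf.1 hg.1, hf.2, hg.2]⟩

theorem HasHalfLineIntegral.sum {ι : Type*} {s : Finset ι} {f : ι → ℝ → ℝ} {a : ι → ℝ}
    (h : ∀ i ∈ s, HasHalfLineIntegral (f i) (a i)) :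
    HasHalfLineIntegral (fun u => ∑ i ∈ s, f i u) (∑ i ∈ s, a i) :=
  ⟨integrable_finsetSum _ fun i hi => (h i hi).1, by
    rw [integral_finsetSum _ fun i hi => (h i hi).1]
    exact Finset.sum_congr rfl fun i hi => (h i hi).2⟩

/-- Fundamental theorem of calculus on the half-line. -/
theorem hasHalfLineIntegral_of_hasDerivAt {F f : ℝ → ℝ} {l : ℝ} (hF : ∀ u, HasDerivAt F (f u) u)
    (hf : IntegrableOn f (Ioi 0)) (hl : Tendsto F atTop (𝓝 l)) :
    HasHalfLineIntegral f (l - F 0) :=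
  ⟨hf, integral_Ioi_of_hasDerivAt_of_tendsto' (fun u _ => hF u) hf hl⟩

/-! ### The function `log (1 + exp (-u))` -/

/-- The function `u ↦ log (1 + exp (-u))`. -/
noncomputable def logOneAddExpNeg (u : ℝ) : ℝ := Real.log (1 + Real.exp (-u))

/-- The Fermi function `u ↦ exp (-u) / (1 + exp (-u))`. -/
noncomputable def fermi (u : ℝ) : ℝ := Real.exp (-u) / (1 + Real.exp (-u))

local notation "L" => logOneAddExpNeg

theorem fermi_pos (u : ℝ) : 0 < fermi u := by unfold fermi; positivity

theorem one_sub_fermi (u : ℝ) : 1 - fermi u = (1 + Real.exp (-u))⁻¹ := by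
  unfold fermi; field_simp; ring

theorem fermi_lt_one (u : ℝ) : fermi u < 1 := by
  have : 0 < 1 - fermi u := by rw [one_sub_fermi]; positivity
  linarith

theorem fermi_neg (u : ℝ) : fermi (-u) = 1 - fermi u := by
  rw [one_sub_fermi, fermi, neg_neg, Real.exp_neg]
  field_simp
  ring

theorem fermi_zero : fermi 0 = 1 / 2 := by norm_num [fermi]

theorem continuous_fermi : Continuous fermi := by
  unfold fermi
  exact Continuous.div (by fun_prop) (by fun_prop) fun u => by positivity

theorem logOneAddExpNeg_pos (u : ℝ) : 0 < L u :=
  Real.log_pos (by linarith [Real.exp_pos (-u)])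

theorem logOneAddExpNeg_le (u : ℝ) : L u ≤ Real.exp (-u) :=
  (Real.log_le_sub_one_of_pos (by positivity)).trans (by simp)

theorem logOneAddExpNeg_zero : L 0 = Real.log 2 := by norm_num [logOneAddExpNeg]

theorem logOneAddExpNeg_neg (u : ℝ) : L (-u) = u + L u := by
  unfold logOneAddExpNeg
  nth_rewrite 2 [← Real.log_exp u]
  rw [← Real.log_mul (by positivity) (by positivity), mul_add, ← Real.exp_add]
  simp [add_comm]

/-- With t = L(u) this reads e^{-t} = 1 - f, the dictionary for every later substitution. -/
theorem exp_neg_logOneAddExpNeg (u : ℝ) : Real.exp (-L u) = 1 - fermi u := by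
  rw [one_sub_fermi, Real.exp_neg, logOneAddExpNeg, Real.exp_log (by positivity)]

theorem log_fermi (u : ℝ) : Real.log (fermi u) = -(u + L u) := by
  rw [← logOneAddExpNeg_neg, ← Real.log_exp (-L (-u)), exp_neg_logOneAddExpNeg, fermi_neg]
  simp

theorem hasDerivAt_logOneAddExpNeg (u : ℝ) : HasDerivAt L (-fermi u) u := by
  have h : HasDerivAt (fun u : ℝ => 1 + Real.exp (-u)) (-Real.exp (-u)) u := by
    simpa using ((hasDerivAt_neg u).exp).const_add 1
  simpa [fermi, neg_div] using! h.log (by positivity)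

theorem hasDerivAt_fermi (u : ℝ) : HasDerivAt fermi (-(fermi u * (1 - fermi u))) u := by
  have h := ((hasDerivAt_logOneAddExpNeg u).neg.exp).const_sub 1
  simp only [Pi.neg_apply, exp_neg_logOneAddExpNeg, sub_sub_cancel] at h
  exact h.congr_deriv (by ring)

theorem continuous_logOneAddExpNeg : Continuous L :=
  continuous_iff_continuousAt.2 fun u => (hasDerivAt_logOneAddExpNeg u).continuousAt

theorem strictAnti_logOneAddExpNeg : StrictAnti L :=
  strictAnti_of_deriv_neg fun u => by
    rw [(hasDerivAt_logOneAddExpNeg u).deriv]; linarith [fermi_pos u]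

theorem range_logOneAddExpNeg : range L = Ioi 0 := by
  refine Subset.antisymm (range_subset_iff.2 logOneAddExpNeg_pos) fun t ht => ?_
  have h : 0 < Real.exp t - 1 := by linarith [Real.add_one_lt_exp (ne_of_gt ht), show 0 < t from ht]
  exact ⟨-Real.log (Real.exp t - 1), by
    rw [logOneAddExpNeg, neg_neg, Real.exp_log h, add_sub_cancel, Real.log_exp]⟩

theorem logOneAddExpNeg_pow_le {a : ℕ} (ha : a ≠ 0) {u : ℝ} (hu : 0 ≤ u) :
    L u ^ a ≤ Real.exp (-u) := by
  have h1 : L u ≤ 1 := (logOneAddExpNeg_le u).trans (Real.exp_le_one_iff.2 (by linarith))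
  exact (pow_le_of_le_one (logOneAddExpNeg_pos u).le h1 ha).trans (logOneAddExpNeg_le u)

theorem tendsto_pow_mul_logOneAddExpNeg_pow (b : ℕ) {a : ℕ} (ha : a ≠ 0) :
    Tendsto (fun u => u ^ b * L u ^ a) atTop (𝓝 0) := by
  refine squeeze_zero' ?_ ?_ (Real.tendsto_pow_mul_exp_neg_atTop_nhds_zero b)
  · filter_upwards [eventually_ge_atTop 0] with u hu
    have := logOneAddExpNeg_pos u
    positivity
  · filter_upwards [eventually_ge_atTop 0] with u hu
    exact mul_le_mul_of_nonneg_left (logOneAddExpNeg_pow_le ha hu) (by positivity)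

theorem tendsto_logOneAddExpNeg_pow {a : ℕ} (ha : a ≠ 0) :
    Tendsto (fun u => L u ^ a) atTop (𝓝 0) := by
  simpa using tendsto_pow_mul_logOneAddExpNeg_pow 0 ha

theorem integrableOn_pow_mul_logOneAddExpNeg_pow (b : ℕ) {a : ℕ} (ha : a ≠ 0) :
    IntegrableOn (fun u => u ^ b * L u ^ a) (Ioi 0) := by
  have h := integrableOn_pow_mul_exp_neg_mul_Ioi b one_pos
  refine h.mono' ?_ ?_
  · exact (by have := continuous_logOneAddExpNeg; fun_prop : Continuous _).aestronglyMeasurable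
  · refine (ae_restrict_iff' measurableSet_Ioi).2 (ae_of_all _ fun u (hu : 0 < u) => ?_)
    have := logOneAddExpNeg_pos u
    rw [Real.norm_of_nonneg (by positivity), one_mul]
    exact mul_le_mul_of_nonneg_left (logOneAddExpNeg_pow_le ha hu.le) (by positivity)

/-! ### Moments and the folding substitution -/

/-- The moments `∫₀^∞ u ^ b * log (1 + exp (-u)) ^ a du`. -/
noncomputable def logMoment (a b : ℕ) : ℝ := ∫ u in Ioi (0 : ℝ), u ^ b * L u ^ a

theorem hasHalfLineIntegral_logMoment {a : ℕ} (ha : a ≠ 0) (b : ℕ) :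
    HasHalfLineIntegral (fun u => u ^ b * L u ^ a) (logMoment a b) :=
  ⟨integrableOn_pow_mul_logOneAddExpNeg_pow b ha, rfl⟩

/-- The substitution `t = log (1 + exp (-u))`, `u ∈ ℝ`, folded onto the half-line. -/
theorem HasHalfLineIntegral.comp_logOneAddExpNeg {g : ℝ → ℝ} {s : ℝ}
    (hg : HasHalfLineIntegral g s) :
    HasHalfLineIntegral (fun u => g (L u) * fermi u + g (u + L u) * (1 - fermi u)) s := by
  have hd : ∀ u ∈ (univ : Set ℝ), HasDerivWithinAt L (-fermi u) univ u := fun u _ =>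
    (hasDerivAt_logOneAddExpNeg u).hasDerivWithinAt
  have hinj : InjOn L univ := strictAnti_logOneAddExpNeg.injective.injOn
  have himg : L '' univ = Ioi 0 := by rw [image_univ, range_logOneAddExpNeg]
  have habs : (fun u => |-fermi u| • g (L u)) = fun u => g (L u) * fermi u := by
    ext u
    rw [abs_neg, abs_of_pos (fermi_pos u), smul_eq_mul, mul_comm]
  have hint := integrableOn_image_iff_integrableOn_abs_deriv_smul MeasurableSet.univ hd hinj g
  have hval := integral_image_eq_integral_abs_deriv_smul MeasurableSet.univ hd hinj g
  rw [himg, habs] at hint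
  rw [himg, hg.2] at hval
  rw [habs] at hval
  have hi : Integrable fun u => g (L u) * fermi u := integrableOn_univ.1 (hint.1 hg.1)
  -- The second summand is the first one at -u, so it accounts for the negative half of ℝ.
  have hneg : (fun u => g (u + L u) * (1 - fermi u)) = fun u => g (L (-u)) * fermi (-u) := by
    ext u
    rw [logOneAddExpNeg_neg, fermi_neg]
  have hi' : Integrable fun u => g (L (-u)) * fermi (-u) := hi.comp_neg
  refine ⟨hi.integrableOn.add (hneg ▸ hi'.integrableOn), ?_⟩
  rw [integral_add hi.integrableOn (hneg ▸ hi'.integrableOn), hneg,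
    integral_comp_neg_Ioi 0 (fun u => g (L u) * fermi u), neg_zero, add_comm,
    intervalIntegral.integral_Iic_add_Ioi hi.integrableOn hi.integrableOn, hval, setIntegral_univ]

theorem HasSum.of_eq {ι : Type*} {f g : ι → ℝ} {s : ℝ} (h : HasSum f s) (e : ∀ i, g i = f i) :
    HasSum g s :=
  (funext e : g = f) ▸ h

/-! ### Zeta values -/

theorem hasSum_zetaR {k : ℕ} (hk : 1 < k) :
    HasSum (fun n : ℕ => 1 / ((n : ℝ) + 1) ^ k) (zetaR k) := by
  have hs : Summable fun n : ℕ => 1 / (n : ℝ) ^ k := Real.summable_one_div_nat_pow.2 hk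
  have h : zetaR k = ∑' n : ℕ, 1 / (n : ℝ) ^ k := by
    rw [← Complex.ofReal_inj, zetaR_eq hk, zeta_nat_eq_tsum_of_gt_one hk, Complex.ofReal_tsum]
    simp
  have h1 : zetaR k = ∑' n : ℕ, 1 / ((n : ℝ) + 1) ^ k := by
    rw [h, hs.tsum_eq_zero_add]
    simp [show k ≠ 0 by omega]
  rw [h1]
  exact_mod_cast ((summable_nat_add_iff 1).2 hs).hasSum

theorem zetaR_eq_of_hasSum {k : ℕ} (hk : 1 < k) {s : ℝ}
    (h : HasSum (fun n : ℕ => (1 : ℝ) / (n : ℝ) ^ k) s) : zetaR k = s := by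
  refine (hasSum_zetaR hk).unique ?_
  simpa [show k ≠ 0 by omega] using (hasSum_nat_add_iff' 1).2 h

theorem zetaR_two : zetaR 2 = Real.pi ^ 2 / 6 := zetaR_eq_of_hasSum (by norm_num) hasSum_zeta_two

theorem zetaR_four : zetaR 4 = Real.pi ^ 4 / 90 := zetaR_eq_of_hasSum (by norm_num) hasSum_zeta_four

/-- The alternating zeta series. -/
theorem hasSum_alternating_zetaR {k : ℕ} (hk : 1 < k) :
    HasSum (fun n : ℕ => (-1 : ℝ) ^ n / ((n : ℝ) + 1) ^ k) ((1 - 2 / 2 ^ k) * zetaR k) := by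
  have hz := hasSum_zetaR hk
  -- Index n stands for the integer n + 1, so odd indices are the even integers.
  have hodd : HasSum (fun n : ℕ => 1 / (((2 * n + 1 : ℕ) : ℝ) + 1) ^ k) (zetaR k / 2 ^ k) := by
    rw [show (fun n : ℕ => 1 / (((2 * n + 1 : ℕ) : ℝ) + 1) ^ k) =
      fun n : ℕ => 1 / ((n : ℝ) + 1) ^ k / 2 ^ k from funext fun n => by
        rw [div_div, ← mul_pow]; push_cast; ring]
    exact hz.div_const _
  have heven : HasSum (fun n : ℕ => 1 / (((2 * n : ℕ) : ℝ) + 1) ^ k)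
      (zetaR k - zetaR k / 2 ^ k) := by
    have hs : Summable fun n : ℕ => 1 / (((2 * n : ℕ) : ℝ) + 1) ^ k :=
      hz.summable.comp_injective (i := fun n : ℕ => 2 * n) fun a b h => by simpa using h
    have := (HasSum.even_add_odd (f := fun n : ℕ => 1 / ((n : ℝ) + 1) ^ k) hs.hasSum hodd).unique hz
    exact eq_sub_of_add_eq this ▸ hs.hasSum
  have h1 : HasSum (fun n : ℕ => (-1 : ℝ) ^ (2 * n) / (((2 * n : ℕ) : ℝ) + 1) ^ k)
      (zetaR k - zetaR k / 2 ^ k) := by simpa [pow_mul] using heven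
  have h2 : HasSum (fun n : ℕ => (-1 : ℝ) ^ (2 * n + 1) / (((2 * n + 1 : ℕ) : ℝ) + 1) ^ k)
      (-(zetaR k / 2 ^ k)) := by simpa [pow_mul, pow_succ, neg_div] using hodd.neg
  convert HasSum.even_add_odd (f := fun n : ℕ => (-1 : ℝ) ^ n / ((n : ℝ) + 1) ^ k) h1 h2 using 1
  ring

/-! ### Integrals given by a single series -/

theorem exp_neg_nat_add_one_mul (n : ℕ) (u : ℝ) :
    Real.exp (-(((n : ℝ) + 1) * u)) = Real.exp (-u) ^ (n + 1) := by
  rw [← Real.exp_nat_mul]; push_cast; ring_nf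

theorem exp_neg_lt_one {u : ℝ} (hu : 0 < u) : Real.exp (-u) < 1 :=
  by simpa using hu

/-- The Bose–Einstein integral. -/
theorem hasHalfLineIntegral_bose {k : ℕ} (hk : k ≠ 0) :
    HasHalfLineIntegral (fun t => t ^ k * (Real.exp (-t) / (1 - Real.exp (-t))))
      (k.factorial * zetaR (k + 1)) := by
  have hz := hasSum_zetaR (show 1 < k + 1 by omega)
  refine hasHalfLineIntegral_pow_mul_of_hasSum k (c := fun _ : ℕ => 1) (r := fun n => (n : ℝ) + 1)
    (fun n => by positivity) (by simpa using hz.summable) hz fun u hu => ?_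
  have h := (hasSum_geometric_of_lt_one (Real.exp_pos (-u)).le (exp_neg_lt_one hu)).mul_left
    (Real.exp (-u))
  rw [div_eq_mul_inv]
  simpa only [one_mul, exp_neg_nat_add_one_mul, pow_succ'] using h

/-- The Fermi–Dirac integral. -/
theorem hasHalfLineIntegral_pow_mul_fermi {k : ℕ} (hk : k ≠ 0) :
    HasHalfLineIntegral (fun u => u ^ k * fermi u)
      (k.factorial * ((1 - 2 / 2 ^ (k + 1)) * zetaR (k + 1))) := by
  refine hasHalfLineIntegral_pow_mul_of_hasSum k (c := fun n : ℕ => (-1) ^ n)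
    (r := fun n => (n : ℝ) + 1) (fun n => by positivity)
    (by simpa using (hasSum_zetaR (show 1 < k + 1 by omega)).summable)
    (hasSum_alternating_zetaR (by omega)) fun u hu => ?_
  have h := (hasSum_geometric_of_abs_lt_one (r := -Real.exp (-u))
    (by rw [abs_neg, Real.abs_exp]; exact exp_neg_lt_one hu)).mul_left (Real.exp (-u))
  rw [sub_neg_eq_add, ← div_eq_mul_inv] at h
  refine h.of_eq fun n => ?_
  rw [exp_neg_nat_add_one_mul, neg_pow]
  ring

theorem hasHalfLineIntegral_pow_mul_logOneAddExpNeg (k : ℕ) :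
    HasHalfLineIntegral (fun u => u ^ k * L u)
      (k.factorial * ((1 - 2 / 2 ^ (k + 2)) * zetaR (k + 2))) := by
  have hdiv (n : ℕ) (x : ℝ) :
      x / ((n : ℝ) + 1) / ((n : ℝ) + 1) ^ (k + 1) = x / ((n : ℝ) + 1) ^ (k + 2) := by
    rw [div_div, ← pow_succ']
  refine hasHalfLineIntegral_pow_mul_of_hasSum k (c := fun n : ℕ => (-1) ^ n / ((n : ℝ) + 1))
    (r := fun n => (n : ℝ) + 1) (fun n => by positivity) ?_ ?_ fun u hu => ?_
  · have h (n : ℕ) : |(-1) ^ n / ((n : ℝ) + 1)| = 1 / ((n : ℝ) + 1) := by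
      rw [abs_div, abs_pow, abs_neg, abs_one, one_pow, abs_of_pos (by positivity)]
    simp only [h, hdiv]
    exact (hasSum_zetaR (by omega)).summable
  · simp only [hdiv]
    exact hasSum_alternating_zetaR (by omega)
  · have h := (Real.hasSum_pow_div_log_of_abs_lt_one (x := -Real.exp (-u))
      (by rw [abs_neg, Real.abs_exp]; exact exp_neg_lt_one hu)).neg
    rw [sub_neg_eq_add, neg_neg] at h
    refine h.of_eq fun n => ?_
    rw [exp_neg_nat_add_one_mul, neg_pow]
    ring

theorem logMoment_one (k : ℕ) :
    logMoment 1 k = k.factorial * ((1 - 2 / 2 ^ (k + 2)) * zetaR (k + 2)) := by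
  rw [← (hasHalfLineIntegral_pow_mul_logOneAddExpNeg k).2, logMoment]
  simp

/-! ### The linear relations between moments of the same weight -/

/-- Removing x^a leaves a positive power of y in each term; with y = L every term decays and is
integrable. -/
theorem add_pow_sub_pow_eq_sum (a : ℕ) (x y : ℝ) :
    (x + y) ^ a - x ^ a = ∑ k ∈ Finset.range a, (a.choose k : ℝ) * (x ^ k * y ^ (a - k)) := by
  rw [add_pow, Finset.sum_range_succ]
  simp only [Nat.sub_self, pow_zero, Nat.choose_self, Nat.cast_one, mul_one, add_sub_cancel_right]
  exact Finset.sum_congr rfl fun k _ => by ring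

theorem tendsto_add_pow_sub_pow (a : ℕ) :
    Tendsto (fun u => (u + L u) ^ a - u ^ a) atTop (𝓝 0) := by
  simp only [add_pow_sub_pow_eq_sum]
  rw [← Finset.sum_const_zero (s := Finset.range a)]
  refine tendsto_finsetSum _ fun k hk => ?_
  have := Finset.mem_range.1 hk
  simpa using (tendsto_pow_mul_logOneAddExpNeg_pow k (a := a - k) (by omega)).const_mul
    (a.choose k : ℝ)

theorem hasHalfLineIntegral_add_pow_sub_pow (a : ℕ) :
    HasHalfLineIntegral (fun u => (u + L u) ^ a - u ^ a)
      (∑ k ∈ Finset.range a, (a.choose k : ℝ) * logMoment (a - k) k) := by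
  simp only [add_pow_sub_pow_eq_sum]
  refine HasHalfLineIntegral.sum fun k hk => ?_
  have := Finset.mem_range.1 hk
  exact (hasHalfLineIntegral_logMoment (by omega) k).const_mul _

/-- The Beta-function relation between the moments of weight `a + 1`. -/
theorem sum_choose_mul_logMoment_add_logMoment {a : ℕ} (ha : a ≠ 0) :
    ∑ k ∈ Finset.range a, (a.choose k : ℝ) * logMoment (a - k) k + logMoment a 0 =
      a.factorial * zetaR (a + 1) := by
  have h1 : HasHalfLineIntegral (fun u => L u ^ a * (1 - fermi u) + (u + L u) ^ a * fermi u)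
      (a.factorial * zetaR (a + 1)) := by
    -- At t = L the Bose factor is (1 - f)/f, and at t = u + L it is f/(1 - f); the Jacobians f and
    -- 1 - f cancel the denominators.
    refine (hasHalfLineIntegral_bose ha).comp_logOneAddExpNeg.congr fun u _ => ?_
    have h0 := (fermi_pos u).ne'
    have h1 : 1 - fermi u ≠ 0 := by linarith [fermi_lt_one u]
    rw [← logOneAddExpNeg_neg, exp_neg_logOneAddExpNeg, exp_neg_logOneAddExpNeg, fermi_neg,
      sub_sub_cancel]
    field_simp
  have h2 := (hasHalfLineIntegral_add_pow_sub_pow a).add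
    ((hasHalfLineIntegral_logMoment ha 0).congr fun u _ => by rw [pow_zero, one_mul])
  have h3 := h2.sub h1
  -- The difference of the two integrands is (u + L)^a (1 - f) - u^a + L^a f, an exact derivative
  -- since (u + L)' = 1 - f. Its primitive vanishes at 0 and at infinity.
  have h4 := hasHalfLineIntegral_of_hasDerivAt
    (F := fun u => ((u + L u) ^ (a + 1) - u ^ (a + 1) - L u ^ (a + 1)) / (a + 1)) (l := 0)
    (fun u => ?_) h3.1 ?_
  · have := h4.2.symm.trans h3.2
    simp only [zero_add, ne_eq, Nat.succ_ne_zero, not_false_eq_true, zero_pow, sub_zero, sub_self,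
      zero_div] at this
    linarith
  · have hL := hasDerivAt_logOneAddExpNeg u
    have hd := (((((hasDerivAt_id u).add hL).pow (a + 1)).sub
      ((hasDerivAt_id u).pow (a + 1))).sub (hL.pow (a + 1))).div_const ((a : ℝ) + 1)
    refine hd.congr_deriv ?_
    have : (a : ℝ) + 1 ≠ 0 := by positivity
    simp only [Nat.cast_add, Nat.cast_one, Nat.add_sub_cancel, id, Pi.add_apply]
    field_simp
    ring
  · simpa using ((tendsto_add_pow_sub_pow (a + 1)).sub
      (tendsto_logOneAddExpNeg_pow (a := a + 1) (by omega))).div_const ((a : ℝ) + 1)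

/-! ### Polylogarithms -/

theorem polylog_one_right {k : ℕ} (hk : 1 < k) : polylog k 1 = zetaR k := by
  simpa [polylog] using (hasSum_zetaR hk).tsum_eq

theorem continuousOn_polylog {k : ℕ} (hk : 1 < k) : ContinuousOn (polylog k) (Icc (-1) 1) := by
  refine continuousOn_tsum (fun n => by fun_prop) (hasSum_zetaR hk).summable fun n z hz => ?_
  rw [norm_div, norm_pow, Real.norm_eq_abs, Real.norm_of_nonneg (by positivity)]
  gcongr
  exact pow_le_one₀ (abs_nonneg _) (abs_le.2 hz)

theorem polylog_one {z : ℝ} (hz : |z| < 1) : polylog 1 z = -Real.log (1 - z) := by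
  simpa [polylog] using (Real.hasSum_pow_div_log_of_abs_lt_one hz).tsum_eq

theorem polylog_zero {z : ℝ} (hz : |z| < 1) : polylog 0 z = z / (1 - z) := by
  simpa [polylog, pow_succ', tsum_mul_left, div_eq_mul_inv] using
    congrArg (z * ·) (tsum_geometric_of_abs_lt_one hz)

theorem hasDerivAt_polylog_succ (m : ℕ) {z : ℝ} (hz : |z| < 1) (hz0 : z ≠ 0) :
    HasDerivAt (polylog (m + 1)) (polylog m z / z) z := by
  -- On |y| < r the differentiated terms are bounded by r^n, which permits termwise differentiation.
  obtain ⟨r, hr, hr1⟩ := exists_between hz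
  have hr0 : 0 ≤ r := (abs_nonneg z).trans hr.le
  have hzr : z ∈ Ioo (-r) r := abs_lt.1 hr
  have h := hasDerivAt_tsum_of_isPreconnected (u := fun n : ℕ => r ^ n)
    (g := fun n z => z ^ (n + 1) / ((n : ℝ) + 1) ^ (m + 1))
    (g' := fun n z => z ^ n / ((n : ℝ) + 1) ^ m)
    (summable_geometric_of_lt_one hr0 hr1) isOpen_Ioo isPreconnected_Ioo
    (fun n y _ => ?_) (fun n y hy => ?_) hzr (hasSum_polylog (m + 1) hz).summable hzr
  · refine h.congr_deriv ?_
    rw [polylog, ← tsum_div_const]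
    refine tsum_congr fun n => ?_
    field_simp
    exact (pow_succ z n).symm
  · refine ((hasDerivAt_pow (n + 1) y).div_const _).congr_deriv ?_
    have : (n : ℝ) + 1 ≠ 0 := by positivity
    push_cast
    field_simp
    ring
  · rw [norm_div, norm_pow, norm_pow, Real.norm_of_nonneg (by positivity : (0 : ℝ) ≤ n + 1)]
    refine (div_le_self (by positivity) (one_le_pow₀ (by simp))).trans ?_
    exact pow_le_pow_left₀ (abs_nonneg _) (abs_lt.2 hy).le _

theorem abs_one_sub_fermi_lt_one (u : ℝ) : |1 - fermi u| < 1 := by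
  rw [abs_lt]; constructor <;> linarith [fermi_pos u, fermi_lt_one u]

/-- For z = 1 - f one has z' = f z, which cancels the 1/z in the derivative of the polylogarithm. -/
theorem hasDerivAt_polylog_comp (m : ℕ) (u : ℝ) :
    HasDerivAt (fun u => polylog (m + 1) (1 - fermi u)) (polylog m (1 - fermi u) * fermi u) u := by
  have h0 : 1 - fermi u ≠ 0 := by linarith [fermi_lt_one u]
  refine ((hasDerivAt_polylog_succ m (abs_one_sub_fermi_lt_one u) h0).comp u
    ((hasDerivAt_fermi u).const_sub 1)).congr_deriv ?_
  field_simp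

/-- An iterated antiderivative: its derivative is
`log (1 + exp (-u)) ^ a * polylog k (1 - fermi u) * fermi u`. -/
noncomputable def polylogPrimitive : ℕ → ℕ → ℝ → ℝ
  | 0, k, u => polylog (k + 1) (1 - fermi u)
  | a + 1, k, u => L u ^ (a + 1) * polylog (k + 1) (1 - fermi u) +
      (a + 1) * polylogPrimitive a (k + 1) u

/-- Integration by parts: differentiating L^(a+1) leaves -(a+1) L^a Li_{k+1} f, which the recursive
term cancels. -/
theorem hasDerivAt_polylogPrimitive (a k : ℕ) (u : ℝ) :
    HasDerivAt (polylogPrimitive a k) (L u ^ a * polylog k (1 - fermi u) * fermi u) u := by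
  induction a generalizing k with
  | zero => simpa [polylogPrimitive] using! hasDerivAt_polylog_comp k u
  | succ a ih =>
    refine ((((hasDerivAt_logOneAddExpNeg u).pow (a + 1)).mul (hasDerivAt_polylog_comp k u)).add
      ((ih (k + 1)).const_mul ((a : ℝ) + 1))).congr_deriv ?_
    simp only [Nat.cast_add, Nat.cast_one, Nat.add_sub_cancel, Pi.pow_apply]
    ring

theorem tendsto_fermi : Tendsto fermi atTop (𝓝 0) := by
  have h : Tendsto (fun u : ℝ => Real.exp (-u)) atTop (𝓝 0) := Real.tendsto_exp_neg_atTop_nhds_zero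
  simpa [fermi] using! h.div (h.const_add 1) (by norm_num)

theorem tendsto_polylog_comp {k : ℕ} (hk : 1 < k) :
    Tendsto (fun u => polylog k (1 - fermi u)) atTop (𝓝 (zetaR k)) := by
  rw [← polylog_one_right hk]
  refine (continuousOn_polylog hk 1 (by simp)).tendsto.comp (tendsto_nhdsWithin_iff.2 ⟨?_, ?_⟩)
  · simpa using tendsto_fermi.const_sub 1
  · exact Eventually.of_forall fun u => abs_le.1 (abs_one_sub_fermi_lt_one u).le

theorem tendsto_pow_mul_polylog_comp {a : ℕ} (ha : a ≠ 0) (k : ℕ) :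
    Tendsto (fun u => L u ^ a * polylog (k + 1) (1 - fermi u)) atTop (𝓝 0) := by
  rcases Nat.eq_zero_or_pos k with rfl | hk
  -- Li_1(1 - f) = -log f = u + L grows only linearly, and L^a decays exponentially.
  · have h (u : ℝ) : L u ^ a * polylog (0 + 1) (1 - fermi u) = u ^ 1 * L u ^ a + L u ^ (a + 1) := by
      rw [zero_add, polylog_one (abs_one_sub_fermi_lt_one u), sub_sub_cancel, log_fermi]
      ring
    simp only [h]
    simpa using (tendsto_pow_mul_logOneAddExpNeg_pow 1 ha).add
      (tendsto_logOneAddExpNeg_pow (a := a + 1) (by omega))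
  · simpa using (tendsto_logOneAddExpNeg_pow ha).mul (tendsto_polylog_comp (k := k + 1) (by omega))

/-- All terms carrying a power of L vanish in the limit, leaving a! Li_{a+k+1}(1). The hypothesis
excludes the divergent Li_1(1). -/
theorem tendsto_polylogPrimitive {a k : ℕ} (h : a + k ≠ 0) :
    Tendsto (polylogPrimitive a k) atTop (𝓝 (a.factorial * zetaR (a + k + 1))) := by
  induction a generalizing k with
  | zero => simpa [polylogPrimitive] using! tendsto_polylog_comp (k := k + 1) (by omega)
  | succ a ih =>
    have := (tendsto_pow_mul_polylog_comp (a := a + 1) (by omega) k).add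
      ((ih (k := k + 1) (by omega)).const_mul ((a : ℝ) + 1))
    rw [zero_add, ← mul_assoc] at this
    convert! this using 2
    rw [Nat.factorial_succ, show a + 1 + k = a + (k + 1) by ring]
    push_cast
    ring

/-- Split L^a = L^a (1 - f) + L^a f. As Li_0(1 - f) f = 1 - f, the first part has primitive
`polylogPrimitive a 0`; the second is the derivative of -L^(a+1)/(a+1). -/
theorem logMoment_zero_right {a : ℕ} (ha : a ≠ 0) :
    logMoment a 0 = a.factorial * zetaR (a + 1) + Real.log 2 ^ (a + 1) / (a + 1)
      - polylogPrimitive a 0 0 := by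
  have hI := (hasHalfLineIntegral_logMoment ha 0).congr fun u _ => by rw [pow_zero, one_mul]
  have h := hasHalfLineIntegral_of_hasDerivAt
    (F := fun u => polylogPrimitive a 0 u - L u ^ (a + 1) / (a + 1))
    (l := a.factorial * zetaR (a + 1)) (fun u => ?_) hI.1 ?_
  · rw [← hI.2, h.2, logOneAddExpNeg_zero]
    ring
  · have h0 := (fermi_pos u).ne'
    refine ((hasDerivAt_polylogPrimitive a 0 u).sub
      (((hasDerivAt_logOneAddExpNeg u).pow (a + 1)).div_const ((a : ℝ) + 1))).congr_deriv ?_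
    have : (a : ℝ) + 1 ≠ 0 := by positivity
    rw [polylog_zero (abs_one_sub_fermi_lt_one u), sub_sub_cancel]
    simp only [Nat.cast_add, Nat.cast_one, Nat.add_sub_cancel]
    field_simp
    ring
  · simpa using (tendsto_polylogPrimitive (a := a) (k := 0) (by omega)).sub
      ((tendsto_logOneAddExpNeg_pow (a := a + 1) (by omega)).div_const ((a : ℝ) + 1))

/-! ### Euler's evaluation of the sum of `H_n / n ^ 4` -/

/-- Telescoping, one unit of m at a time; this brings the harmonic number H_m in as an infinite
series. -/
theorem hasSum_one_div_sub_one_div_add (m : ℕ) :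
    HasSum (fun k : ℕ => 1 / ((k : ℝ) + 1) - 1 / ((k : ℝ) + 1 + m))
      (∑ i ∈ Finset.range m, 1 / ((i : ℝ) + 1)) := by
  induction m with
  | zero => simp
  | succ m ih =>
    rw [Finset.sum_range_succ]
    have h : HasSum (fun k : ℕ => 1 / ((k : ℝ) + (m + 1)) - 1 / (((k + 1 : ℕ) : ℝ) + (m + 1)))
        (1 / ((m : ℝ) + 1)) := by
      rw [hasSum_iff_tendsto_nat_of_nonneg]
      · have h0 : Tendsto (fun n : ℕ => 1 / ((n : ℝ) + (m + 1))) atTop (𝓝 0) :=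
          tendsto_const_nhds.div_atTop
            (tendsto_natCast_atTop_atTop.atTop_add tendsto_const_nhds)
        simp only [Finset.sum_range_sub' fun k : ℕ => 1 / ((k : ℝ) + (m + 1))]
        simpa using h0.const_sub (1 / ((m : ℝ) + 1))
      · intro k
        rw [sub_nonneg]
        gcongr
        simp
    refine (ih.add h).of_eq fun k => ?_
    push_cast
    rw [show (k : ℝ) + 1 + (m + 1) = k + 1 + (m + 1) from rfl,
      show (k : ℝ) + 1 + m = k + (m + 1) by ring]
    ring

theorem hasSum_prod_of_row_col {f : ℕ × ℕ → ℝ} {a b : ℝ} (h0 : HasSum (fun k => f (k, 0)) a)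
    (h1 : HasSum (fun p : ℕ × ℕ => f (p.1, p.2 + 1)) b) : HasSum f (a + b) := by
  let e : ℕ ⊕ ℕ × ℕ → ℕ × ℕ := Sum.elim (fun k => (k, 0)) fun p => (p.1, p.2 + 1)
  have he : e.Bijective := by
    constructor
    · rintro (x | ⟨x, y⟩) (x' | ⟨x', y'⟩) h <;> simp_all [e]
    · rintro ⟨x, _ | y⟩
      · exact ⟨.inl x, rfl⟩
      · exact ⟨.inr (x, y), rfl⟩
  exact (Equiv.ofBijective e he).hasSum_iff.1 (HasSum.sum h0 h1)

theorem hasSum_prod_of_diag {f : ℕ × ℕ → ℝ} {a b c : ℝ} (h0 : HasSum (fun k => f (k, k)) a)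
    (h1 : HasSum (fun p : ℕ × ℕ => f (p.1, p.1 + p.2 + 1)) b)
    (h2 : HasSum (fun p : ℕ × ℕ => f (p.1 + p.2 + 1, p.1)) c) : HasSum f (a + (b + c)) := by
  let e : ℕ ⊕ (ℕ × ℕ ⊕ ℕ × ℕ) → ℕ × ℕ := Sum.elim (fun k => (k, k))
    (Sum.elim (fun p => (p.1, p.1 + p.2 + 1)) fun p => (p.1 + p.2 + 1, p.1))
  have he : e.Bijective := by
    constructor
    · rintro (x | ⟨x, y⟩ | ⟨x, y⟩) (x' | ⟨x', y'⟩ | ⟨x', y'⟩) h <;>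
        simp [e] at h ⊢ <;> omega
    · rintro ⟨x, y⟩
      rcases lt_trichotomy x y with h | h | h
      · exact ⟨.inr (.inl (x, y - x - 1)), Prod.ext rfl (by simp [e]; omega)⟩
      · exact ⟨.inl x, by simp [e, h]⟩
      · exact ⟨.inr (.inr (y, x - y - 1)), Prod.ext (by simp [e]; omega) rfl⟩
  exact (Equiv.ofBijective e he).hasSum_iff.1 (HasSum.sum h0 (HasSum.sum h1 h2))

/-- Euler's sum `∑ H_n / n ^ 4 = 3 ζ(5) - ζ(2) ζ(3)`, written as a double series. -/
theorem hasSum_euler_four :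
    HasSum (fun p : ℕ × ℕ => 1 / ((p.1 : ℝ) + 1) / ((p.1 : ℝ) + p.2 + 1) ^ 4)
      (3 * zetaR 5 - zetaR 2 * zetaR 3) := by
  have h2 := hasSum_zetaR (k := 2) (by norm_num)
  have h3 := hasSum_zetaR (k := 3) (by norm_num)
  have h5 := hasSum_zetaR (k := 5) (by norm_num)
  have hdom : Summable fun p : ℕ × ℕ => 1 / ((p.1 : ℝ) + 1) ^ 2 * (1 / ((p.2 : ℝ) + 1) ^ 2) :=
    h2.summable.mul_of_nonneg h2.summable (fun n => by positivity) fun n => by positivity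
  have hsum (f : ℕ × ℕ → ℝ) (hf : ∀ p, ((p.1 : ℝ) + 1) ^ 2 * ((p.2 : ℝ) + 1) ^ 2 ≤ f p) :
      Summable fun p => 1 / f p := by
    have hpos (p : ℕ × ℕ) : 0 < ((p.1 : ℝ) + 1) ^ 2 * ((p.2 : ℝ) + 1) ^ 2 := by positivity
    refine hdom.of_nonneg_of_le (fun p => one_div_nonneg.2 ((hpos p).le.trans (hf p))) fun p => ?_
    rw [one_div_mul_one_div]
    exact one_div_le_one_div_of_le (hpos p) (hf p)
  have hN (p : ℕ × ℕ) : (p.1 : ℝ) + 1 ≤ p.1 + p.2 + 2 ∧ (p.2 : ℝ) + 1 ≤ p.1 + p.2 + 2 ∧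
      (1 : ℝ) ≤ p.1 + 1 := by
    have := Nat.cast_nonneg (α := ℝ) p.1
    have := Nat.cast_nonneg (α := ℝ) p.2
    refine ⟨?_, ?_, ?_⟩ <;> linarith
  -- With m = p.1 + 1 and N = p.1 + p.2 + 2 > m, the sums b, c, d are the double zeta values ζ(4,1),
  -- ζ(3,2), ζ(2,3).
  obtain ⟨b, hb⟩ := hsum (fun p => ((p.1 : ℝ) + 1) * ((p.1 : ℝ) + p.2 + 2) ^ 4) fun p => by
    obtain ⟨h1, h2, h3⟩ := hN p
    calc _ ≤ ((p.1 : ℝ) + p.2 + 2) ^ 2 * ((p.1 : ℝ) + p.2 + 2) ^ 2 := by gcongr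
      _ = 1 * ((p.1 : ℝ) + p.2 + 2) ^ 4 := by ring
      _ ≤ _ := by gcongr
  obtain ⟨c, hc⟩ := hsum (fun p => ((p.1 : ℝ) + 1) ^ 2 * ((p.1 : ℝ) + p.2 + 2) ^ 3) fun p => by
    obtain ⟨h1, h2, h3⟩ := hN p
    calc _ ≤ ((p.1 : ℝ) + 1) ^ 2 * ((p.1 : ℝ) + p.2 + 2) ^ 2 := by gcongr
      _ ≤ _ := by gcongr <;> linarith
  obtain ⟨d, hd⟩ := hsum (fun p => ((p.1 : ℝ) + 1) ^ 3 * ((p.1 : ℝ) + p.2 + 2) ^ 2) fun p => by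
    obtain ⟨h1, h2, h3⟩ := hN p
    calc _ ≤ ((p.1 : ℝ) + 1) ^ 2 * ((p.1 : ℝ) + p.2 + 2) ^ 2 := by gcongr
      _ ≤ _ := by gcongr; linarith
  have hb' : HasSum (fun p : ℕ × ℕ => 1 / (((p.2 : ℝ) + 1) * ((p.1 : ℝ) + p.2 + 2) ^ 4)) b := by
    refine ((Equiv.prodComm ℕ ℕ).hasSum_iff.2 hb).of_eq fun p => ?_
    simp [add_comm]
  -- the full double series and its expression through `b`
  have htot : HasSum (fun p : ℕ × ℕ => 1 / ((p.1 : ℝ) + 1) / ((p.1 : ℝ) + p.2 + 1) ^ 4)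
      (zetaR 5 + b) := by
    refine hasSum_prod_of_row_col
      (f := fun p : ℕ × ℕ => 1 / ((p.1 : ℝ) + 1) / ((p.1 : ℝ) + p.2 + 1) ^ 4) (h5.of_eq fun n => ?_) (hb.of_eq fun p => ?_)
    · rw [Nat.cast_zero, add_zero, div_div, ← pow_succ']
    · push_cast
      rw [div_div]
      ring_nf
  -- stuffle relation
  have hst : zetaR 2 * zetaR 3 = zetaR 5 + (c + d) := by
    have hpos (k n : ℕ) : 0 ≤ 1 / ((n : ℝ) + 1) ^ k := by positivity
    have hs := h2.summable.mul_of_nonneg h3.summable (hpos 2) (hpos 3)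
    have hprod := h2.mul h3 hs
    refine hprod.unique (hasSum_prod_of_diag
      (f := fun p : ℕ × ℕ => 1 / ((p.1 : ℝ) + 1) ^ 2 * (1 / ((p.2 : ℝ) + 1) ^ 3)) (h5.of_eq fun n => ?_) (hc.of_eq fun p => ?_)
      (hd.of_eq fun p => ?_))
    · rw [one_div_mul_one_div, ← pow_add]
    · push_cast
      rw [one_div_mul_one_div]
      ring_nf
    · push_cast
      rw [one_div_mul_one_div]
      ring_nf
  -- partial fractions
  have ha : HasSum (fun p : ℕ × ℕ => 1 / ((p.1 : ℝ) + 1) ^ 4 *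
      (1 / ((p.2 : ℝ) + 1) - 1 / ((p.2 : ℝ) + 1 + (p.1 + 1 : ℕ)))) (b + (b + (c + d))) := by
    -- With k = p.2 + 1 and N = m + k, repeated use of 1/(mk) = (1/m + 1/k)/N gives 1/(m^3 k N) =
    -- 1/(k N^4) + 1/(m N^4) + 1/(m^2 N^3) + 1/(m^3 N^2).
    refine (hb'.add (hb.add (hc.add hd))).of_eq fun p => ?_
    have h1 : (p.1 : ℝ) + 1 ≠ 0 := by positivity
    have h2 : (p.2 : ℝ) + 1 ≠ 0 := by positivity
    have h3 : (p.2 : ℝ) + 1 + (p.1 + 1) ≠ 0 := by positivity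
    rw [show (p.1 : ℝ) + p.2 + 2 = p.2 + 1 + (p.1 + 1) by ring]
    push_cast
    field_simp
    ring
  -- Rows of this series and antidiagonals of the full one both sum to H_n/n^4. So ζ(5) + b = 2b + c
  -- + d, and the stuffle relation eliminates c + d.
  have hrows := ha.prod_fiberwise fun m =>
    (hasSum_one_div_sub_one_div_add (m + 1)).mul_left (1 / ((m : ℝ) + 1) ^ 4)
  have hdiag := (Finset.HasAntidiagonal.sigmaAntidiagonalEquivProd.hasSum_iff.2 htot).sigma
    fun n => hasSum_fintype _
  have heq : zetaR 5 + b = b + (b + (c + d)) := by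
    refine hdiag.unique (hrows.of_eq fun n => ?_)
    simp only [Function.comp, Finset.HasAntidiagonal.sigmaAntidiagonalEquivProd_apply]
    rw [Finset.sum_coe_sort (Finset.HasAntidiagonal.antidiagonal n)
      fun p : ℕ × ℕ => 1 / ((p.1 : ℝ) + 1) / ((p.1 : ℝ) + p.2 + 1) ^ 4,
      Finset.Nat.sum_antidiagonal_eq_sum_range_succ_mk, Finset.mul_sum]
    refine Finset.sum_congr rfl fun i hi => ?_
    have : i ≤ n := by simpa [Nat.lt_succ_iff] using hi
    push_cast [this]
    rw [add_sub_cancel, one_div_mul_one_div, div_div, mul_comm]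
  convert htot using 1
  linarith

/-- The integral whose terms are the Euler sum of `H_n / n ^ 4`. -/
theorem hasHalfLineIntegral_euler :
    HasHalfLineIntegral
      (fun t => t ^ 3 * (-Real.log (1 - Real.exp (-t)) / (1 - Real.exp (-t))))
      (6 * (3 * zetaR 5 - zetaR 2 * zetaR 3)) := by
  have h := hasHalfLineIntegral_pow_mul_of_hasSum 3
    (c := fun p : ℕ × ℕ => 1 / ((p.1 : ℝ) + 1)) (r := fun p : ℕ × ℕ => (p.1 : ℝ) + p.2 + 1)
    (F := fun t => -Real.log (1 - Real.exp (-t)) / (1 - Real.exp (-t)))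
    (fun p => by positivity) ?_ hasSum_euler_four fun t ht => ?_
  · simpa [Nat.factorial] using! h
  · refine hasSum_euler_four.summable.congr fun p => ?_
    rw [abs_of_pos (by positivity)]
  · have he := Real.exp_pos (-t)
    have h1 := Real.hasSum_pow_div_log_of_abs_lt_one (x := Real.exp (-t))
      (by rw [Real.abs_exp]; exact exp_neg_lt_one ht)
    have h2 := hasSum_geometric_of_lt_one he.le (exp_neg_lt_one ht)
    -- The product of the logarithmic and geometric series is kept as a double series, matching
    -- Euler's sum.
    rw [div_eq_mul_inv]
    refine (h1.mul h2 (h1.summable.mul_of_nonneg h2.summable (fun n => by positivity)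
      fun n => by positivity)).of_eq fun p => ?_
    rw [show (p.1 : ℝ) + p.2 + 1 = ((p.1 + p.2 : ℕ) : ℝ) + 1 by push_cast; ring,
      exp_neg_nat_add_one_mul]
    ring

theorem logMoment_euler :
    2 * logMoment 4 0 + 4 * logMoment 3 1 + 3 * logMoment 2 2 + logMoment 1 3 =
      6 * (3 * zetaR 5 - zetaR 2 * zetaR 3) := by
  have h1 := hasHalfLineIntegral_euler.comp_logOneAddExpNeg
  have h2 := ((((hasHalfLineIntegral_logMoment (a := 4) (by norm_num) 0).const_mul 2).add
    ((hasHalfLineIntegral_logMoment (a := 3) (by norm_num) 1).const_mul 4)).add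
    ((hasHalfLineIntegral_logMoment (a := 2) (by norm_num) 2).const_mul 3)).add
    (hasHalfLineIntegral_logMoment (a := 1) (by norm_num) 3)
  -- The folded integrand is L^3 (u + L) + (u + L)^3 L, since -log(1 - e^{-t}) is u + L at t = L and
  -- L at t = u + L.
  rw [← h2.2, ← (h1.congr fun u _ => ?_).2]
  have h0 := (fermi_pos u).ne'
  have h1 : 1 - fermi u ≠ 0 := by linarith [fermi_lt_one u]
  rw [← logOneAddExpNeg_neg, exp_neg_logOneAddExpNeg, exp_neg_logOneAddExpNeg, fermi_neg,
    sub_sub_cancel, log_fermi, ← fermi_neg, log_fermi, fermi_neg,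
    logOneAddExpNeg_neg]
  field_simp
  ring


/-! ### Values of the moments -/

theorem polylog_one_half : polylog 1 (1 / 2) = Real.log 2 := by
  rw [polylog_one (by norm_num [abs_of_pos]), show (1 : ℝ) - 1 / 2 = 2⁻¹ by norm_num, Real.log_inv,
    neg_neg]

theorem polylogPrimitive_zero_left (k : ℕ) :
    polylogPrimitive 0 k 0 = polylog (k + 1) (1 / 2) := by
  norm_num [polylogPrimitive, fermi_zero]

theorem polylogPrimitive_succ_left (a k : ℕ) :
    polylogPrimitive (a + 1) k 0 = Real.log 2 ^ (a + 1) * polylog (k + 1) (1 / 2) +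
      (a + 1) * polylogPrimitive a (k + 1) 0 := by
  norm_num [polylogPrimitive, fermi_zero, logOneAddExpNeg_zero]

theorem logMoment_one_zero : logMoment 1 0 = Real.pi ^ 2 / 12 := by
  rw [logMoment_one, zetaR_two]; norm_num; ring

theorem logMoment_one_one : logMoment 1 1 = 3 / 4 * zetaR 3 := by
  rw [logMoment_one]; norm_num

theorem logMoment_one_two : logMoment 1 2 = 7 * Real.pi ^ 4 / 360 := by
  rw [logMoment_one, zetaR_four]; norm_num; ring

theorem logMoment_one_three : logMoment 1 3 = 45 / 8 * zetaR 5 := by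
  rw [logMoment_one]; norm_num [Nat.factorial]; ring

theorem logMoment_two_zero : logMoment 2 0 = zetaR 3 / 4 := by
  have h := sum_choose_mul_logMoment_add_logMoment (a := 2) (by norm_num)
  norm_num [Finset.sum_range_succ, logMoment_one_one] at h
  linarith

/-- M(1,0) is already known from its series, so the polylogarithmic formula for it can be solved for
Li_2(1/2). -/
theorem polylog_two_half :
    polylog 2 (1 / 2) = Real.pi ^ 2 / 12 - Real.log 2 ^ 2 / 2 := by
  have h := logMoment_zero_right (a := 1) (by norm_num)
  norm_num [polylogPrimitive_succ_left, polylogPrimitive_zero_left, logMoment_one_zero, zetaR_two,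
    polylog_one_half, -one_div] at h
  linarith

theorem polylog_three_half :
    polylog 3 (1 / 2) =
      7 / 8 * zetaR 3 - Real.pi ^ 2 / 12 * Real.log 2 + Real.log 2 ^ 3 / 6 := by
  have h := logMoment_zero_right (a := 2) (by norm_num)
  norm_num [polylogPrimitive_succ_left, polylogPrimitive_zero_left, logMoment_two_zero,
    polylog_one_half, polylog_two_half, -one_div] at h
  linarith

theorem logMoment_three_zero :
    logMoment 3 0 = 1 / 4 * Real.pi ^ 2 * Real.log 2 ^ 2 - 21 / 4 * Real.log 2 * zetaR 3
      - 6 * polylog 4 (1 / 2) + 1 / 15 * Real.pi ^ 4 - 1 / 4 * Real.log 2 ^ 4 := by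
  rw [logMoment_zero_right (by norm_num)]
  norm_num [polylogPrimitive_succ_left, polylogPrimitive_zero_left, zetaR_four, Nat.factorial,
    polylog_one_half, polylog_two_half, polylog_three_half, -one_div]
  ring

theorem logMoment_four_zero :
    logMoment 4 0 = 2 / 3 * Real.pi ^ 2 * Real.log 2 ^ 3 - 21 / 2 * Real.log 2 ^ 2 * zetaR 3
      - 24 * Real.log 2 * polylog 4 (1 / 2) - 4 / 5 * Real.log 2 ^ 5
      - 24 * polylog 5 (1 / 2) + 24 * zetaR 5 := by
  rw [logMoment_zero_right (by norm_num)]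
  norm_num [polylogPrimitive_succ_left, polylogPrimitive_zero_left, Nat.factorial,
    polylog_one_half, polylog_two_half, polylog_three_half, -one_div]
  ring

theorem logMoment_two_one :
    logMoment 2 1 = 4 * polylog 4 (1 / 2) - 1 / 24 * Real.pi ^ 4
      - 1 / 6 * Real.pi ^ 2 * Real.log 2 ^ 2 + 1 / 6 * Real.log 2 ^ 4
      + 7 / 2 * Real.log 2 * zetaR 3 := by
  have h := sum_choose_mul_logMoment_add_logMoment (a := 3) (by norm_num)
  norm_num [Finset.sum_range_succ, logMoment_one_two, logMoment_three_zero, zetaR_four,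
    Nat.factorial, Nat.choose, -one_div] at h
  linarith

theorem sum_logMoment_four : 2 * logMoment 4 0 + 4 * logMoment 3 1 + 6 * logMoment 2 2 +
    4 * logMoment 1 3 = 24 * zetaR 5 := by
  have h := sum_choose_mul_logMoment_add_logMoment (a := 4) (by norm_num)
  norm_num [Finset.sum_range_succ, Nat.factorial, Nat.choose] at h
  linarith

/-- The two weight-five relations share the part 2 M(4,0) + 4 M(3,1); their difference involves only
M(2,2) and M(1,3). -/
theorem logMoment_two_two :
    logMoment 2 2 = -(29 / 8) * zetaR 5 + 1 / 3 * Real.pi ^ 2 * zetaR 3 := by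
  have h1 := sum_logMoment_four
  have h2 := logMoment_euler
  rw [logMoment_one_three] at h1 h2
  rw [zetaR_two] at h2
  linarith

theorem logMoment_three_one :
    logMoment 3 1 = 12 * polylog 5 (1 / 2) + 12 * Real.log 2 * polylog 4 (1 / 2)
      + 2 / 5 * Real.log 2 ^ 5 + 21 / 4 * zetaR 3 * Real.log 2 ^ 2 - 99 / 16 * zetaR 5
      - 1 / 3 * Real.pi ^ 2 * Real.log 2 ^ 3 - 1 / 2 * zetaR 3 * Real.pi ^ 2 := by
  have h := sum_logMoment_four
  rw [logMoment_one_three, logMoment_two_two, logMoment_four_zero] at h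
  linarith

/-! ### The mixed integral and the final assembly -/

theorem hasHalfLineIntegral_cube_mul_logOneAddExpNeg_mul_fermi :
    HasHalfLineIntegral (fun u => u ^ 3 * L u * fermi u) (3 / 2 * logMoment 2 2) := by
  have hint : IntegrableOn (fun u => u ^ 3 * L u * fermi u) (Ioi 0) := by
    refine (integrableOn_pow_mul_logOneAddExpNeg_pow 3 one_ne_zero).mono' ?_
      ((ae_restrict_iff' measurableSet_Ioi).2 (ae_of_all _ fun u (hu : 0 < u) => ?_))
    · have := continuous_logOneAddExpNeg
      have := continuous_fermi
      exact (by fun_prop : Continuous _).aestronglyMeasurable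
    · have h1 := logOneAddExpNeg_pos u
      have h2 := fermi_pos u
      rw [Real.norm_of_nonneg (by positivity), pow_one]
      exact mul_le_of_le_one_right (by positivity) (fermi_lt_one u).le
  have h1 := (hasHalfLineIntegral_logMoment (a := 2) (by norm_num) 2).const_mul (3 / 2)
  -- The derivative of u^3 L^2 / 2 is 3/2 u^2 L^2 - u^3 L f, and both boundary values are 0.
  have h2 := hasHalfLineIntegral_of_hasDerivAt (F := fun u => 1 / 2 * (u ^ 3 * L u ^ 2)) (l := 0)
    (fun u => ?_) (h1.1.sub hint) ?_
  · simpa using h1.sub h2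
  · refine ((((hasDerivAt_id u).pow 3).mul
      ((hasDerivAt_logOneAddExpNeg u).pow 2)).const_mul (1 / 2 : ℝ)).congr_deriv ?_
    simp
    ring
  · rw [← mul_zero (1 / 2 : ℝ)]
    exact (tendsto_pow_mul_logOneAddExpNeg_pow 3 (by norm_num)).const_mul _

theorem mainTheorem2 :
    HasHalfLineIntegral (fun u => 1 / 4 * Real.log (1 + Real.exp (-u)))
      (Real.pi ^ 2 / 48) ∧
    HasHalfLineIntegral (fun u => u * Real.log (1 + Real.exp (-u)))
      (3 / 4 * zetaR 3) ∧
    HasHalfLineIntegral (fun u => Real.log (1 + Real.exp (-u)) ^ 2)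
      (zetaR 3 / 4) ∧
    HasHalfLineIntegral (fun u => u ^ 3 * Real.exp (-u) / (1 + Real.exp (-u)))
      (7 * Real.pi ^ 4 / 120) ∧
    HasHalfLineIntegral (fun u => Real.log (1 + Real.exp (-u)) ^ 3)
      (1 / 4 * Real.pi ^ 2 * Real.log 2 ^ 2 - 21 / 4 * Real.log 2 * zetaR 3
        - 6 * polylog 4 (1 / 2) + 1 / 15 * Real.pi ^ 4 - 1 / 4 * Real.log 2 ^ 4) ∧
    HasHalfLineIntegral (fun u => u * Real.log (1 + Real.exp (-u)) ^ 2)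
      (4 * polylog 4 (1 / 2) - 1 / 24 * Real.pi ^ 4 - 1 / 6 * Real.pi ^ 2 * Real.log 2 ^ 2
        + 1 / 6 * Real.log 2 ^ 4 + 7 / 2 * Real.log 2 * zetaR 3) ∧
    HasHalfLineIntegral (fun u => u ^ 4 * Real.exp (-u) / (1 + Real.exp (-u)))
      (45 / 2 * zetaR 5) ∧
    HasHalfLineIntegral (fun u => u * Real.log (1 + Real.exp (-u)) ^ 3)
      (12 * polylog 5 (1 / 2) + 12 * Real.log 2 * polylog 4 (1 / 2) + 2 / 5 * Real.log 2 ^ 5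
        + 21 / 4 * zetaR 3 * Real.log 2 ^ 2 - 99 / 16 * zetaR 5
        - 1 / 3 * Real.pi ^ 2 * Real.log 2 ^ 3 - 1 / 2 * zetaR 3 * Real.pi ^ 2) ∧
    HasHalfLineIntegral
      (fun u => u ^ 3 * Real.exp (-u) * Real.log (1 + Real.exp (-u)) / (1 + Real.exp (-u)))
      (-(87 / 16) * zetaR 5 + 1 / 2 * Real.pi ^ 2 * zetaR 3) ∧
    HasHalfLineIntegral (fun u => Real.log (1 + Real.exp (-u)) ^ 4)
      (2 / 3 * Real.pi ^ 2 * Real.log 2 ^ 3 - 21 / 2 * Real.log 2 ^ 2 * zetaR 3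
        - 24 * Real.log 2 * polylog 4 (1 / 2) - 4 / 5 * Real.log 2 ^ 5
        - 24 * polylog 5 (1 / 2) + 24 * zetaR 5) := by
  have hM (a b : ℕ) (ha : a ≠ 0) :
      HasHalfLineIntegral (fun u => u ^ b * Real.log (1 + Real.exp (-u)) ^ a) (logMoment a b) :=
    hasHalfLineIntegral_logMoment ha b
  have hfermi (k : ℕ) (hk : k ≠ 0) :
      HasHalfLineIntegral (fun u => u ^ k * Real.exp (-u) / (1 + Real.exp (-u)))
        (k.factorial * ((1 - 2 / 2 ^ (k + 1)) * zetaR (k + 1))) :=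
    (hasHalfLineIntegral_pow_mul_fermi hk).congr fun u _ => (mul_div_assoc _ _ _).symm
  rw [← logMoment_one_one, ← logMoment_two_zero, ← logMoment_three_zero, ← logMoment_two_one,
    ← logMoment_three_one, ← logMoment_four_zero]
  refine ⟨?_, ?_, ?_, ?_, ?_, ?_, ?_, ?_, ?_, ?_⟩
  · have h := (hM 1 0 (by norm_num)).const_mul (1 / 4)
    rw [show Real.pi ^ 2 / 48 = 1 / 4 * logMoment 1 0 by rw [logMoment_one_zero]; ring]
    exact h.congr fun u _ => by ring
  · exact (hM 1 1 (by norm_num)).congr fun u _ => by ring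
  · exact (hM 2 0 (by norm_num)).congr fun u _ => by ring
  · convert! hfermi 3 (by norm_num) using 1
    rw [zetaR_four]
    norm_num [Nat.factorial]
    ring
  · exact (hM 3 0 (by norm_num)).congr fun u _ => by ring
  · exact (hM 2 1 (by norm_num)).congr fun u _ => by ring
  · convert! hfermi 4 (by norm_num) using 1
    norm_num [Nat.factorial]
    ring
  · exact (hM 3 1 (by norm_num)).congr fun u _ => by ring
  · rw [show -(87 / 16) * zetaR 5 + 1 / 2 * Real.pi ^ 2 * zetaR 3 = 3 / 2 * logMoment 2 2 by
      rw [logMoment_two_two]; ring]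
    exact hasHalfLineIntegral_cube_mul_logOneAddExpNeg_mul_fermi.congr fun u _ => by
      rw [fermi, logOneAddExpNeg]; ring
  · exact (hM 4 0 (by norm_num)).congr fun u _ => by ring
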